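/- Let $\mathcal H_a,\mathcal H_b$ be finite-dimensional complex Hilbert spaces, and let $\{\Pi_k\}$ be a projective measurement on $\mathcal H_a$, i.e. finitely many mutually orthogonal orthogonal projections with $\sum_k\Pi_k=\mathbb 1$ (for example the rank-one projections $|k\rangle\langle k|$ of an orthonormal basis). Put $\Pi^a(X)=\sum_k(\Pi_k\otimes\mathbb 1)X(\Pi_k\otimes\mathbb 1)$ for operators $X$ on $\mathcal H_a\otimes\mathcal H_b$, and let $\mathcal I_p=\{\sigma:\ \sigma\text{ is a state on }\mathcal H_a\otimes\mathcal H_b,\ \Pi^a(\sigma)=\sigma\}$ be the set of partially incoherent states (a state is a positive semidefinite operator of trace one). For a strength $x\in\mathbb R$ put $\tau_1=\sqrt{(1-\tanh x)/2}$, $\tau_2=\sqrt{(1+\tanh x)/2}$, $\tau=2\tau_1\tau_2=\operatorname{sech}x$. Let $\Omega$ be either of the following weak measurement maps: (i) if the measurement consists of two projections $\Pi_1,\Pi_2$, $$\Omega(X)=\sum_{k=\pm x}(\Omega_k\otimes\mathbb 1)X(\Omega_k\otimes\mathbb 1),\qquad \Omega_x=\tau_1\Pi_1+\tau_2\Pi_2,\quad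 \Omega_{-x}=\tau_2\Pi_1+\tau_1\Pi_2;$$ (ii) for any number of projections, $\Omega(X)=\tau X+(1-\tau)\Pi^a(X)$. Define the coherence relative to the weak measurement by $C_H(\rho|\Omega)=\|\sqrt\rho-\Omega(\sqrt\rho)\|^2$, where $\|Y\|=\sqrt{\operatorname{tr}(Y^\dagger Y)}$. Let $\Phi$ be a completely positive trace preserving map on the operators on $\mathcal H_a\otimes\mathcal H_b$, i.e. $\Phi(X)=\sum_k A_kXA_k^\dagger$ with finitely many operators $A_k$ satisfying $\sum_kA_k^\dagger A_k=\mathbb 1$, and suppose that $\Phi$ is partially incoherent, i.e. $\Phi(\mathcal I_p)\subseteq\mathcal I_p$. Then for every state $\rho$ on $\mathcal H_a\otimes\mathcal H_b$, $$C_H(\Phi(\rho)|\Omega)\le C_H(\rho|\Omega).$$ -/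

import Mathlib

open scoped Kronecker ComplexOrder

noncomputable section

namespace WeakCoherence

/-- Density matrices (states): positive semidefinite with unit trace. -/
def IsState {n : Type*} [Fintype n] (ρ : Matrix n n ℂ) : Prop :=
  ρ.PosSemidef ∧ ρ.trace = 1

open scoped MatrixOrder in
/-- The positive semidefinite square root of a positive semidefinite matrix. -/
def msqrt {n : Type*} [Fintype n] [DecidableEq n] (ρ : Matrix n n ℂ) : Matrix n n ℂ :=
  CFC.sqrt ρ

/-- The Hilbert-Schmidt norm `√(tr(X†X))`. -/
def hsNorm {n : Type*} [Fintype n] (X : Matrix n n ℂ) : ℝ :=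
  Real.sqrt (Matrix.trace (Matrix.conjTranspose X * X)).re

/-- Hellinger coherence relative to a map `M` on matrices: `‖√ρ - M(√ρ)‖²`. -/
def coherence {n : Type*} [Fintype n] [DecidableEq n]
    (M : Matrix n n ℂ → Matrix n n ℂ) (ρ : Matrix n n ℂ) : ℝ :=
  hsNorm (msqrt ρ - M (msqrt ρ)) ^ 2

/-- A projective measurement: mutually orthogonal orthogonal projections summing to the identity.
Rank-one projections `|k⟩⟨k|` onto the vectors of an orthonormal basis are a special case. -/
structure IsProjectiveMeasurement {a : Type*} [Fintype a] [DecidableEq a] {m : ℕ}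
    (P : Fin m → Matrix a a ℂ) : Prop where
  hermitian : ∀ k, (P k).IsHermitian
  idem : ∀ k, P k * P k = P k
  orthogonal : ∀ j k, j ≠ k → P j * P k = 0
  complete : ∑ k, P k = 1

/-- The local measurement map `Π^a(X) = ∑ₖ (Pₖ ⊗ 1) X (Pₖ ⊗ 1)`. -/
def localMeas {a b : Type*} [Fintype a] [Fintype b] [DecidableEq b] {m : ℕ}
    (P : Fin m → Matrix a a ℂ) (X : Matrix (a × b) (a × b) ℂ) : Matrix (a × b) (a × b) ℂ :=
  ∑ k, (P k ⊗ₖ (1 : Matrix b b ℂ)) * X * (P k ⊗ₖ (1 : Matrix b b ℂ))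

/-- The set `I_p` of partially incoherent states: states `ρ` with `Π^a(ρ) = ρ`. -/
def partiallyIncoherent {a : Type*} (b : Type*) [Fintype a] [Fintype b] [DecidableEq b] {m : ℕ}
    (P : Fin m → Matrix a a ℂ) : Set (Matrix (a × b) (a × b) ℂ) :=
  {ρ | IsState ρ ∧ localMeas P ρ = ρ}

/-- The weight `τ₁ = √((1 - tanh x)/2)`. -/
def tau₁ (x : ℝ) : ℝ := Real.sqrt ((1 - Real.tanh x) / 2)

/-- The weight `τ₂ = √((1 + tanh x)/2)`. -/
def tau₂ (x : ℝ) : ℝ := Real.sqrt ((1 + Real.tanh x) / 2)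

/-- The two-outcome weak measurement operator `Ω_x = τ₁ P₁ + τ₂ P₂`. -/
def weakOpPos {a : Type*} (x : ℝ) (P : Fin 2 → Matrix a a ℂ) : Matrix a a ℂ :=
  (tau₁ x : ℂ) • P 0 + (tau₂ x : ℂ) • P 1

/-- The two-outcome weak measurement operator `Ω_{-x} = τ₂ P₁ + τ₁ P₂`. -/
def weakOpNeg {a : Type*} (x : ℝ) (P : Fin 2 → Matrix a a ℂ) : Matrix a a ℂ :=
  (tau₂ x : ℂ) • P 0 + (tau₁ x : ℂ) • P 1

/-- The weak measurement map `Ω(X) = ∑_{k = ±x} (Ω_k ⊗ 1) X (Ω_k ⊗ 1)` of two projections. -/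
def weakMeas {a b : Type*} [Fintype a] [Fintype b] [DecidableEq b]
    (x : ℝ) (P : Fin 2 → Matrix a a ℂ) (X : Matrix (a × b) (a × b) ℂ) :
    Matrix (a × b) (a × b) ℂ :=
  (weakOpPos x P ⊗ₖ (1 : Matrix b b ℂ)) * X * (weakOpPos x P ⊗ₖ (1 : Matrix b b ℂ)) +
    (weakOpNeg x P ⊗ₖ (1 : Matrix b b ℂ)) * X * (weakOpNeg x P ⊗ₖ (1 : Matrix b b ℂ))

/-- The weak measurement map `Ω(X) = τ X + (1 - τ) Π^a(X)`, `τ = 2 τ₁ τ₂ = sech x`, of a projective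
measurement with any number of outcomes. -/
def weakMeasMix {a b : Type*} [Fintype a] [Fintype b] [DecidableEq b] {m : ℕ}
    (x : ℝ) (P : Fin m → Matrix a a ℂ) (X : Matrix (a × b) (a × b) ℂ) :
    Matrix (a × b) (a × b) ℂ :=
  ((2 * tau₁ x * tau₂ x : ℝ) : ℂ) • X + ((1 - 2 * tau₁ x * tau₂ x : ℝ) : ℂ) • localMeas P X

/-- Completely positive trace preserving maps: `Φ(X) = ∑ₖ Aₖ X Aₖ†` with `∑ₖ Aₖ† Aₖ = 1`. -/
def IsCPTP {n : Type*} [Fintype n] [DecidableEq n]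
    (Φ : Matrix n n ℂ →ₗ[ℂ] Matrix n n ℂ) : Prop :=
  ∃ (r : ℕ) (A : Fin r → Matrix n n ℂ),
    ∑ k, Matrix.conjTranspose (A k) * A k = 1 ∧
      ∀ X, Φ X = ∑ k, A k * X * Matrix.conjTranspose (A k)

/-- A partially incoherent CPTP map: a CPTP map `Φ` with `Φ(I_p) ⊆ I_p`. -/
def IsPartiallyIncoherentCPTP {a b : Type*} [Fintype a] [DecidableEq a] [Fintype b] [DecidableEq b]
    {m : ℕ} (P : Fin m → Matrix a a ℂ)
    (Φ : Matrix (a × b) (a × b) ℂ →ₗ[ℂ] Matrix (a × b) (a × b) ℂ) : Prop :=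
  IsCPTP Φ ∧ Φ '' partiallyIncoherent b P ⊆ partiallyIncoherent b P

end WeakCoherence

end

/-! Both weak measurements act as `τ X + (1 - τ) Π^a(X)`, and `Π^a` is an orthogonal projection for
the Hilbert-Schmidt inner product. Hence the coherence of `ρ` is `(1 - τ)² (1 - tr Π^a(√ρ)²)`, and
the claim is that `Φ` does not decrease `t = tr Π^a(√ρ)²`.

If `t > 0`, the incoherent state `σ = Π^a(√ρ)² / t` has affinity `tr(√ρ √σ) = √t`. Affinity does not
decrease under `Φ` (`re_trace_msqrt_mul_msqrt_le`). Since `Φ(σ)` is again incoherent, its square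
root is fixed by `Π^a`, so Cauchy-Schwarz bounds its affinity with `Φ(ρ)` by the square root of the
new `t`.

For the affinity, let `T` be the Heisenberg dual of `Φ`. The Kadison-Schwarz inequality bounds `‖√ρ
T(X)‖²` and `‖T(X) √σ‖²` by quadratic forms in `X` which are simultaneously diagonal in the matrix
units built from eigenbases of `Φ(ρ)` and `Φ(σ)`. The Hermitian form `tr(T(X)† √ρ T(X) √σ)` is then
at most their geometric mean (`re_quadForm_le_sum_sqrt_mul`), and `X = 1` gives the inequality. -/

namespace WeakCoherence

open Matrix

/-! ### Hermitian forms and geometric means of diagonal forms -/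

/-- Rayleigh bound: a Hermitian matrix all of whose eigenvalues are at most one has quadratic form
at most `∑ |wᵢ|²`. -/
theorem re_quadForm_le_of_eigenvalue_le_one {κ : Type*} [Fintype κ] [DecidableEq κ]
    {Z : Matrix κ κ ℂ} (hZ : Z.IsHermitian)
    (h : ∀ (l : ℝ) (z : κ → ℂ), z ≠ 0 → Z *ᵥ z = (l : ℂ) • z → l ≤ 1) (w : κ → ℂ) :
    (star w ⬝ᵥ Z *ᵥ w).re ≤ ∑ i, ‖w i‖ ^ 2 := by
  have hH : (1 - Z).IsHermitian := Matrix.isHermitian_one.sub hZ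
  have hP : (1 - Z).PosSemidef := by
    rw [hH.posSemidef_iff_eigenvalues_nonneg]
    intro j
    have hj := hH.mulVec_eigenvectorBasis j
    have hz : ((hH.eigenvectorBasis j).ofLp : κ → ℂ) ≠ 0 := by
      intro h0
      apply hH.eigenvectorBasis.toBasis.ne_zero j
      ext i
      simpa using congrFun h0 i
    have := h (1 - hH.eigenvalues j) _ hz (by
      rw [sub_mulVec, one_mulVec] at hj
      have e : Z *ᵥ (hH.eigenvectorBasis j).ofLp = (hH.eigenvectorBasis j).ofLp -
          hH.eigenvalues j • (hH.eigenvectorBasis j).ofLp := by rw [← hj]; abel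
      rw [e]
      ext i
      simp [sub_mul])
    simpa using this
  have h1 := (Complex.le_def.1 (hP.dotProduct_mulVec_nonneg w)).1
  rw [sub_mulVec, one_mulVec, dotProduct_sub, Complex.sub_re] at h1
  have h2 : (star w ⬝ᵥ w).re = ∑ i, ‖w i‖ ^ 2 := by
    simp only [dotProduct, Pi.star_apply, Complex.re_sum, RCLike.star_def]
    refine Finset.sum_congr rfl fun i _ => ?_
    rw [← Complex.normSq_eq_norm_sq, mul_comm, Complex.mul_conj, Complex.ofReal_re]
  rw [h2] at h1
  simpa using h1

/-- Rescaling coordinates by `(p i * q i)^(1/4)` turns the geometric mean into the identity form, so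
it suffices to bound the eigenvalues of the rescaled matrix `Z` by one. Positivity makes the
rescaling invertible. -/
theorem re_quadForm_le_sum_sqrt_mul_of_pos {κ : Type*} [Fintype κ] [DecidableEq κ]
    {M : Matrix κ κ ℂ} (hM : M.IsHermitian) {p q : κ → ℝ} (hp : ∀ i, 0 < p i) (hq : ∀ i, 0 < q i)
    (h : ∀ u v : κ → ℂ, ‖star u ⬝ᵥ M *ᵥ v‖ ^ 2 ≤
      (∑ i, p i * ‖u i‖ ^ 2) * ∑ i, q i * ‖v i‖ ^ 2) (w : κ → ℂ) :
    (star w ⬝ᵥ M *ᵥ w).re ≤ ∑ i, √(p i * q i) * ‖w i‖ ^ 2 := by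
  set s : κ → ℝ := fun i => √(p i * q i) with hs
  have hs0 : ∀ i, 0 < s i := fun i => Real.sqrt_pos.2 (mul_pos (hp i) (hq i))
  have hss : ∀ i, s i * s i = p i * q i := fun i =>
    Real.mul_self_sqrt (mul_pos (hp i) (hq i)).le
  set r : κ → ℝ := fun i => √(s i) with hr
  have hr0 : ∀ i, 0 < r i := fun i => Real.sqrt_pos.2 (hs0 i)
  have hrr : ∀ i, r i * r i = s i := fun i => Real.mul_self_sqrt (hs0 i).le
  have hrc : ∀ i, (r i : ℂ) ≠ 0 := fun i => by exact_mod_cast (hr0 i).ne'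
  set Z : Matrix κ κ ℂ := Matrix.of fun i j => M i j / (r i * r j) with hZdef
  have hZ : Z.IsHermitian := by
    ext i j
    have := congrFun (congrFun hM i) j
    simp only [conjTranspose_apply, RCLike.star_def] at this
    simp [hZdef, this, mul_comm]
  have hMv : ∀ v : κ → ℂ, ∀ i, (M *ᵥ v) i = r i * (Z *ᵥ fun j => r j * v j) i := by
    intro v i
    simp only [mulVec, dotProduct, Finset.mul_sum]
    refine Finset.sum_congr rfl fun j _ => ?_
    have := hrc i; have := hrc j
    simp only [hZdef, of_apply]
    field_simp
  have key : ∀ (l : ℝ) (z : κ → ℂ), z ≠ 0 → Z *ᵥ z = (l : ℂ) • z → l ≤ 1 := by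
    intro l z hz hl
    set v : κ → ℂ := fun i => z i / r i with hv
    have hrv : (fun j => (r j : ℂ) * v j) = z := by
      ext j; have := hrc j; simp only [hv]; field_simp
    set N : ℝ := ∑ i, q i * ‖v i‖ ^ 2 with hN
    have hN0 : 0 < N := by
      obtain ⟨i, hi⟩ := Function.ne_iff.1 hz
      refine Finset.sum_pos' (fun i _ => by have := hq i; positivity) ⟨i, Finset.mem_univ _, ?_⟩
      have : v i ≠ 0 := div_ne_zero hi (hrc i)
      have := hq i
      positivity
    -- The factor `s / p = √(q / p)` makes the `p`-form of the first vector equal to the `q`-form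
    -- `N` of `v`, while the pairing is `l * N`; hence `l² N² ≤ N²`.
    have h1 := h (fun i => ((s i / p i : ℝ) : ℂ) * v i) v
    have h2 : ∑ i, p i * ‖((s i / p i : ℝ) : ℂ) * v i‖ ^ 2 = N := by
      refine Finset.sum_congr rfl fun i _ => ?_
      rw [norm_mul, Complex.norm_real, mul_pow, Real.norm_eq_abs, sq_abs, div_pow, sq (s i), hss]
      have := (hp i).ne'
      field_simp
    have h3 : (star (fun i => ((s i / p i : ℝ) : ℂ) * v i) ⬝ᵥ M *ᵥ v) = ((l * N : ℝ) : ℂ) := by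
      rw [hN, Finset.mul_sum, Complex.ofReal_sum]
      refine Finset.sum_congr rfl fun i _ => ?_
      rw [hMv, hrv, hl]
      simp only [Pi.star_apply, Pi.smul_apply, smul_eq_mul, star_mul', RCLike.star_def,
        Complex.conj_ofReal]
      have hz' : z i = r i * v i := (congrFun hrv i).symm
      rw [hz']
      have e1 : ((s i / p i : ℝ) : ℂ) * ((r i : ℂ) * r i) = (q i : ℂ) := by
        have : s i / p i * (r i * r i) = q i := by
          rw [hrr, div_mul_eq_mul_div, hss]; have := (hp i).ne'; field_simp
        exact_mod_cast this
      have e2 : (starRingEnd ℂ) (v i) * v i = ((‖v i‖ ^ 2 : ℝ) : ℂ) := by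
        rw [mul_comm, Complex.mul_conj, Complex.normSq_eq_norm_sq]
      rw [Complex.ofReal_mul, Complex.ofReal_mul, ← e1, ← e2]
      ring
    rw [h2, h3, Complex.norm_real, Real.norm_eq_abs, sq_abs] at h1
    have h4 : l ^ 2 ≤ 1 := by
      by_contra hc
      push Not at hc
      nlinarith [mul_pos hN0 hN0]
    nlinarith
  have h5 := re_quadForm_le_of_eigenvalue_le_one hZ key (fun j => r j * w j)
  have h6 : star (fun j => (r j : ℂ) * w j) ⬝ᵥ Z *ᵥ (fun j => (r j : ℂ) * w j) =
      star w ⬝ᵥ M *ᵥ w := by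
    refine Finset.sum_congr rfl fun i _ => ?_
    rw [hMv]
    simp only [Pi.star_apply, star_mul', RCLike.star_def, Complex.conj_ofReal]
    ring
  rw [h6] at h5
  refine h5.trans (le_of_eq (Finset.sum_congr rfl fun i _ => ?_))
  rw [norm_mul, mul_pow, Complex.norm_real, Real.norm_eq_abs, sq_abs, sq (r i), hrr]

/-- A Hermitian form dominated, in the Cauchy-Schwarz sense, by the diagonal forms `p` and `q` is
dominated by their geometric mean. -/
theorem re_quadForm_le_sum_sqrt_mul {κ : Type*} [Fintype κ] [DecidableEq κ]
    {M : Matrix κ κ ℂ} (hM : M.IsHermitian) {p q : κ → ℝ} (hp : ∀ i, 0 ≤ p i) (hq : ∀ i, 0 ≤ q i)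
    (h : ∀ u v : κ → ℂ, ‖star u ⬝ᵥ M *ᵥ v‖ ^ 2 ≤
      (∑ i, p i * ‖u i‖ ^ 2) * ∑ i, q i * ‖v i‖ ^ 2) (w : κ → ℂ) :
    (star w ⬝ᵥ M *ᵥ w).re ≤ ∑ i, √(p i * q i) * ‖w i‖ ^ 2 := by
  have hε : ∀ ε : ℝ, 0 < ε →
      (star w ⬝ᵥ M *ᵥ w).re ≤ ∑ i, √((p i + ε) * (q i + ε)) * ‖w i‖ ^ 2 := by
    intro ε hε
    refine re_quadForm_le_sum_sqrt_mul_of_pos hM (fun i => by linarith [hp i])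
      (fun i => by linarith [hq i]) (fun u v => (h u v).trans ?_) w
    have h1 : ∀ (f : κ → ℝ) (u : κ → ℂ), (∀ i, 0 ≤ f i) → 0 ≤ ∑ i, f i * ‖u i‖ ^ 2 :=
      fun f u hf => Finset.sum_nonneg fun i _ => mul_nonneg (hf i) (by positivity)
    refine mul_le_mul ?_ ?_ (h1 _ _ hq) (h1 _ _ fun i => by linarith [hp i]) <;>
    · gcongr
      linarith
  have hc : Continuous fun ε : ℝ => ∑ i, √((p i + ε) * (q i + ε)) * ‖w i‖ ^ 2 := by fun_prop
  have ht : Filter.Tendsto (fun ε : ℝ => ∑ i, √((p i + ε) * (q i + ε)) * ‖w i‖ ^ 2)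
      (nhdsWithin 0 (Set.Ioi 0)) (nhds (∑ i, √(p i * q i) * ‖w i‖ ^ 2)) := by
    have := (hc.tendsto 0).mono_left (nhdsWithin_le_nhds (s := Set.Ioi 0))
    simpa using this
  exact ge_of_tendsto ht (Filter.eventually_of_mem self_mem_nhdsWithin hε)

/-! ### The Hilbert-Schmidt inner product -/

theorem trace_conjTranspose_mul {m n : Type*} [Fintype m] [Fintype n] (X Y : Matrix m n ℂ) :
    (Xᴴ * Y).trace = ∑ j, ∑ i, star (X i j) * Y i j := by
  simp [trace, mul_apply]

theorem re_trace_conjTranspose_mul_self {m n : Type*} [Fintype m] [Fintype n]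
    (X : Matrix m n ℂ) : (Xᴴ * X).trace.re = ∑ j, ∑ i, ‖X i j‖ ^ 2 := by
  rw [trace_conjTranspose_mul, Complex.re_sum]
  refine Finset.sum_congr rfl fun j _ => ?_
  rw [Complex.re_sum]
  refine Finset.sum_congr rfl fun i _ => ?_
  rw [← Complex.normSq_eq_norm_sq, RCLike.star_def, mul_comm, Complex.mul_conj, Complex.ofReal_re]

theorem re_trace_conjTranspose_mul_self_nonneg {m n : Type*} [Fintype m] [Fintype n]
    (X : Matrix m n ℂ) : 0 ≤ (Xᴴ * X).trace.re := by
  rw [re_trace_conjTranspose_mul_self]; positivity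

/-- Cauchy-Schwarz for the Hilbert-Schmidt inner product. -/
theorem norm_trace_conjTranspose_mul_sq_le {m n : Type*} [Fintype m] [Fintype n]
    (X Y : Matrix m n ℂ) :
    ‖(Xᴴ * Y).trace‖ ^ 2 ≤ (Xᴴ * X).trace.re * (Yᴴ * Y).trace.re := by
  rw [re_trace_conjTranspose_mul_self, re_trace_conjTranspose_mul_self, trace_conjTranspose_mul,
    ← Fintype.sum_prod_type', ← Fintype.sum_prod_type', ← Fintype.sum_prod_type']
  refine le_trans ?_ (Finset.sum_mul_sq_le_sq_mul_sq _ _ _)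
  gcongr
  refine (norm_sum_le _ _).trans (le_of_eq (Finset.sum_congr rfl fun i _ => ?_))
  rw [norm_mul, norm_star]

/-- Operator form of `re_quadForm_le_sum_sqrt_mul`, for the form `tr((K c)† (L d))`. -/
theorem re_trace_le_sum_sqrt_mul {κ m n : Type*} [Fintype κ] [DecidableEq κ] [Fintype m]
    [Fintype n] (K L : (κ → ℂ) →ₗ[ℂ] Matrix m n ℂ)
    (hsymm : ∀ c d, star ((K c)ᴴ * L d).trace = ((K d)ᴴ * L c).trace)
    {p q : κ → ℝ} (hp : ∀ i, 0 ≤ p i) (hq : ∀ i, 0 ≤ q i)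
    (hK : ∀ c, ((K c)ᴴ * K c).trace.re ≤ ∑ i, p i * ‖c i‖ ^ 2)
    (hL : ∀ c, ((L c)ᴴ * L c).trace.re ≤ ∑ i, q i * ‖c i‖ ^ 2) (c : κ → ℂ) :
    ((K c)ᴴ * L c).trace.re ≤ ∑ i, √(p i * q i) * ‖c i‖ ^ 2 := by
  set M : Matrix κ κ ℂ :=
    Matrix.of fun i j => ((K (Pi.single i 1))ᴴ * L (Pi.single j 1)).trace with hM
  have hform : ∀ u v : κ → ℂ, star u ⬝ᵥ M *ᵥ v = ((K u)ᴴ * L v).trace := by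
    intro u v
    have hu : K u = ∑ i, u i • K (Pi.single i 1) := by
      conv_lhs => rw [pi_eq_sum_univ' u, map_sum]
      simp
    have hv : L v = ∑ i, v i • L (Pi.single i 1) := by
      conv_lhs => rw [pi_eq_sum_univ' v, map_sum]
      simp
    rw [hu, hv]
    simp only [conjTranspose_sum, conjTranspose_smul, Matrix.sum_mul, Matrix.mul_sum, trace_sum,
      Matrix.smul_mul, Matrix.mul_smul, trace_smul, dotProduct, mulVec, hM, of_apply,
      Pi.star_apply, smul_eq_mul, Finset.mul_sum]
    rw [Finset.sum_comm]
    refine Finset.sum_congr rfl fun i _ => Finset.sum_congr rfl fun j _ => ?_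
    ring
  have hH : M.IsHermitian := by
    ext i j
    simp only [conjTranspose_apply, hM, of_apply, hsymm]
  rw [← hform]
  refine re_quadForm_le_sum_sqrt_mul hH hp hq (fun u v => ?_) c
  rw [hform]
  refine (norm_trace_conjTranspose_mul_sq_le _ _).trans ?_
  exact mul_le_mul (hK u) (hL v) (re_trace_conjTranspose_mul_self_nonneg _)
    ((re_trace_conjTranspose_mul_self_nonneg _).trans (hK u))

/-! ### Square roots, Kadison-Schwarz and monotonicity of the affinity -/

section affinity

variable {n : Type*} [Fintype n]

section msqrt

variable [DecidableEq n]

open scoped MatrixOrder in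
theorem msqrt_posSemidef (A : Matrix n n ℂ) : (msqrt A).PosSemidef :=
  (CFC.sqrt_nonneg A).posSemidef

open scoped MatrixOrder in
theorem msqrt_mul_self {A : Matrix n n ℂ} (hA : A.PosSemidef) : msqrt A * msqrt A = A :=
  CFC.sqrt_mul_sqrt_self A hA.nonneg

open scoped MatrixOrder in
theorem msqrt_mul_self_eq {B : Matrix n n ℂ} (hB : B.PosSemidef) : msqrt (B * B) = B :=
  CFC.sqrt_unique rfl hB.nonneg

open scoped MatrixOrder in
theorem commute_msqrt {A Q : Matrix n n ℂ} (h : Commute A Q) : Commute (msqrt A) Q :=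
  h.cfcₙ_nnreal _

theorem exists_eq_mul_diagonal_mul {A : Matrix n n ℂ} (hA : A.PosSemidef) :
    ∃ (U : Matrix n n ℂ) (a : n → ℝ), Uᴴ * U = 1 ∧ U * Uᴴ = 1 ∧ (∀ i, 0 ≤ a i) ∧
      A = U * diagonal (fun i => (a i : ℂ)) * Uᴴ ∧
      msqrt A = U * diagonal (fun i => (√(a i) : ℂ)) * Uᴴ := by
  set U : Matrix n n ℂ := (hA.1.eigenvectorUnitary : Matrix n n ℂ) with hU
  have h1 : Uᴴ * U = 1 := Unitary.coe_star_mul_self hA.1.eigenvectorUnitary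
  have h2 : U * Uᴴ = 1 := Unitary.coe_mul_star_self hA.1.eigenvectorUnitary
  have h3 : A = U * diagonal (fun i => (hA.1.eigenvalues i : ℂ)) * Uᴴ := by
    conv_lhs => rw [hA.1.spectral_theorem, Unitary.conjStarAlgAut_apply]
    rfl
  refine ⟨U, hA.1.eigenvalues, h1, h2, hA.eigenvalues_nonneg, h3, ?_⟩
  set D : Matrix n n ℂ := diagonal (fun i => (√(hA.1.eigenvalues i) : ℂ)) with hD
  have hDD : D * D = diagonal (fun i => (hA.1.eigenvalues i : ℂ)) := by
    rw [hD, diagonal_mul_diagonal]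
    congr 1
    ext i
    rw [← Complex.ofReal_mul, Real.mul_self_sqrt (hA.eigenvalues_nonneg i)]
  have hP : (U * D * Uᴴ).PosSemidef := by
    refine PosSemidef.mul_mul_conjTranspose_same (PosSemidef.diagonal fun i => ?_) U
    exact Complex.zero_le_real.2 (Real.sqrt_nonneg _)
  have hsq : (U * D * Uᴴ) * (U * D * Uᴴ) = A := by
    calc (U * D * Uᴴ) * (U * D * Uᴴ) = U * D * (Uᴴ * U) * D * Uᴴ := by
          simp only [Matrix.mul_assoc]
      _ = U * (D * D) * Uᴴ := by rw [h1, Matrix.mul_one, Matrix.mul_assoc U]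
      _ = A := by rw [hDD, ← h3]
  rw [← msqrt_mul_self_eq hP, hsq]

end msqrt

theorem re_trace_diagonal_mul_diagonal_mul [DecidableEq n] (a b : n → ℝ) (C : Matrix n n ℂ) :
    (diagonal (fun i => (a i : ℂ)) * C * diagonal (fun i => (b i : ℂ)) * Cᴴ).trace.re =
      ∑ i : n × n, a i.1 * b i.2 * ‖C i.1 i.2‖ ^ 2 := by
  rw [Fintype.sum_prod_type]
  simp only [trace, diag_apply, Complex.re_sum]
  refine Finset.sum_congr rfl fun i _ => ?_
  rw [mul_apply, Complex.re_sum]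
  refine Finset.sum_congr rfl fun j _ => ?_
  rw [mul_diagonal, diagonal_mul, conjTranspose_apply, ← Complex.normSq_eq_norm_sq,
    ← Complex.ofReal_re (a i * b j * Complex.normSq (C i j))]
  congr 1
  push_cast
  rw [← Complex.mul_conj, RCLike.star_def]
  ring

/-- The Heisenberg dual of the map with Kraus operators `A`. -/
def krausDual {r : ℕ} (A : Fin r → Matrix n n ℂ) : Matrix n n ℂ →ₗ[ℂ] Matrix n n ℂ where
  toFun X := ∑ k, (A k)ᴴ * X * A k
  map_add' X Y := by simp [Matrix.mul_add, Matrix.add_mul, Finset.sum_add_distrib]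
  map_smul' c X := by simp [Finset.smul_sum]

section kraus

variable {r : ℕ} (A : Fin r → Matrix n n ℂ)

theorem krausDual_apply (X : Matrix n n ℂ) : krausDual A X = ∑ k, (A k)ᴴ * X * A k := rfl

theorem krausDual_conjTranspose (X : Matrix n n ℂ) : krausDual A Xᴴ = (krausDual A X)ᴴ := by
  simp [krausDual_apply, conjTranspose_sum, Matrix.mul_assoc]

theorem trace_mul_krausDual (ρ X : Matrix n n ℂ) :
    (ρ * krausDual A X).trace = ((∑ k, A k * ρ * (A k)ᴴ) * X).trace := by
  simp only [krausDual_apply, Matrix.mul_sum, Matrix.sum_mul, trace_sum]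
  refine Finset.sum_congr rfl fun k _ => ?_
  rw [← Matrix.mul_assoc, ← Matrix.mul_assoc, trace_mul_comm]
  simp only [Matrix.mul_assoc]

/-- Kadison-Schwarz inequality for a unital completely positive map. -/
theorem krausDual_sub_posSemidef [DecidableEq n] (hA : ∑ k, (A k)ᴴ * A k = 1)
    (X : Matrix n n ℂ) :
    (krausDual A (X * Xᴴ) - krausDual A X * (krausDual A X)ᴴ).PosSemidef := by
  set T := krausDual A X with hT
  -- The defect is a sum of squares: after summing over `k`, the two cross terms and the last term
  -- are each `± T * Tᴴ`, the last by `hA`.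
  have h : krausDual A (X * Xᴴ) - T * Tᴴ =
      ∑ k, (Xᴴ * A k - A k * Tᴴ)ᴴ * (Xᴴ * A k - A k * Tᴴ) := by
    have e : ∀ k, (Xᴴ * A k - A k * Tᴴ)ᴴ * (Xᴴ * A k - A k * Tᴴ) =
        (A k)ᴴ * (X * Xᴴ) * A k - ((A k)ᴴ * X * A k) * Tᴴ - T * ((A k)ᴴ * Xᴴ * A k) +
          T * ((A k)ᴴ * A k) * Tᴴ := by
      intro k
      simp only [conjTranspose_sub, conjTranspose_mul, conjTranspose_conjTranspose]
      noncomm_ring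
    simp only [e, Finset.sum_add_distrib, Finset.sum_sub_distrib, ← Matrix.sum_mul,
      ← Matrix.mul_sum, hA, ← krausDual_apply, krausDual_conjTranspose, ← hT, Matrix.mul_one]
    abel
  rw [h]
  exact posSemidef_sum _ fun k _ => posSemidef_conjTranspose_mul_self _

/-- Kadison-Schwarz sandwiched between two copies of `S`, with the trace moved to the Schrödinger
side. With `S = √ρ` the right side involves only `Φ ρ`, so it is diagonal in an eigenbasis of `Φ ρ`.
-/
theorem re_trace_mul_krausDual_le [DecidableEq n] (hA : ∑ k, (A k)ᴴ * A k = 1)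
    {S : Matrix n n ℂ} (hS : S.IsHermitian) (X : Matrix n n ℂ) :
    ((S * krausDual A X)ᴴ * (S * krausDual A X)).trace.re ≤
      ((∑ k, A k * (S * S) * (A k)ᴴ) * (X * Xᴴ)).trace.re := by
  rw [← trace_mul_krausDual]
  have h := (krausDual_sub_posSemidef A hA X).mul_mul_conjTranspose_same S
  have h1 := (Complex.le_def.1 h.trace_nonneg).1
  rw [Matrix.mul_sub, Matrix.sub_mul, trace_sub, Complex.sub_re, hS.eq] at h1
  have e1 : ((S * krausDual A X)ᴴ * (S * krausDual A X)).trace =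
      (S * (krausDual A X * (krausDual A X)ᴴ) * S).trace := by
    rw [trace_mul_comm, conjTranspose_mul, hS.eq]
    simp only [Matrix.mul_assoc]
  have e2 : (S * S * krausDual A (X * Xᴴ)).trace = (S * krausDual A (X * Xᴴ) * S).trace := by
    rw [trace_mul_comm (S * krausDual A (X * Xᴴ)), Matrix.mul_assoc]
  rw [e1, e2]
  simpa using h1

end kraus

/-- Monotonicity of the quantum affinity `tr(√ρ √σ)` under completely positive trace preserving
maps. -/
theorem re_trace_msqrt_mul_msqrt_le [DecidableEq n] {Φ : Matrix n n ℂ →ₗ[ℂ] Matrix n n ℂ}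
    (hΦ : IsCPTP Φ) {ρ σ : Matrix n n ℂ} (hρ : ρ.PosSemidef) (hσ : σ.PosSemidef) :
    (msqrt ρ * msqrt σ).trace.re ≤ (msqrt (Φ ρ) * msqrt (Φ σ)).trace.re := by
  obtain ⟨r, A, hA, hΦA⟩ := hΦ
  have hpos : ∀ {τ : Matrix n n ℂ}, τ.PosSemidef → (Φ τ).PosSemidef := by
    intro τ hτ
    rw [hΦA]
    exact posSemidef_sum _ fun k _ => hτ.mul_mul_conjTranspose_same _
  obtain ⟨U, p, hU1, hU2, hp, hρU, hsU⟩ := exists_eq_mul_diagonal_mul (hpos hρ)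
  obtain ⟨V, q, hV1, hV2, hq, hσV, hsV⟩ := exists_eq_mul_diagonal_mul (hpos hσ)
  set S := msqrt ρ with hS
  set R := msqrt σ with hR
  have hSS : S * S = ρ := msqrt_mul_self hρ
  have hRR : R * R = σ := msqrt_mul_self hσ
  have hSH : Sᴴ = S := (msqrt_posSemidef ρ).1
  have hRH : Rᴴ = R := (msqrt_posSemidef σ).1
  -- Coordinates adapted to both outputs: left factor in the eigenbasis of `Φ ρ`, right factor in
  -- that of `Φ σ`.
  let X : (n × n → ℂ) →ₗ[ℂ] Matrix n n ℂ :=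
    { toFun := fun c => U * (Matrix.of fun i j => c (i, j)) * Vᴴ
      map_add' := fun c d => by
        rw [← Matrix.add_mul, ← Matrix.mul_add]; rfl
      map_smul' := fun t c => by
        rw [RingHom.id_apply, ← Matrix.smul_mul, ← Matrix.mul_smul]; rfl }
  have hX : ∀ c, X c = U * (Matrix.of fun i j => c (i, j)) * Vᴴ := fun c => rfl
  let T := krausDual A
  have hT : ∀ Y, T Y = krausDual A Y := fun Y => rfl
  -- The coefficients `Uᴴ * V` are those of the identity matrix, which the unital dual `T` fixes, so
  -- the left side becomes `tr(S R)`.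
  have key := re_trace_le_sum_sqrt_mul
    (LinearMap.mulLeft ℂ S ∘ₗ T ∘ₗ X) (LinearMap.mulRight ℂ R ∘ₗ T ∘ₗ X)
    (p := fun i => p i.1) (q := fun i => q i.2) ?_ (fun i => hp i.1) (fun i => hq i.2) ?_ ?_
    (fun i => (Uᴴ * V) i.1 i.2)
  · have hX1 : X (fun i => (Uᴴ * V) i.1 i.2) = 1 := by
      rw [hX]
      change U * (Uᴴ * V) * Vᴴ = 1
      rw [← Matrix.mul_assoc, hU2, Matrix.one_mul, hV2]
    have hT1 : T 1 = 1 := by simp [hT, krausDual_apply, hA]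
    simp only [LinearMap.comp_apply, LinearMap.mulLeft_apply, LinearMap.mulRight_apply, hX1, hT1,
      Matrix.mul_one, Matrix.one_mul, hSH] at key
    refine key.trans (le_of_eq ?_)
    have e := re_trace_diagonal_mul_diagonal_mul (fun i => √(p i)) (fun i => √(q i)) (Uᴴ * V)
    simp only [Real.sqrt_mul (hp _)]
    rw [← e, hsU, hsV, conjTranspose_mul, conjTranspose_conjTranspose]
    simp only [Matrix.mul_assoc]
    rw [trace_mul_comm U]
    simp only [Matrix.mul_assoc]
  · intro c d
    simp only [LinearMap.comp_apply, LinearMap.mulLeft_apply, LinearMap.mulRight_apply]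
    rw [← trace_conjTranspose, conjTranspose_mul, conjTranspose_conjTranspose, conjTranspose_mul,
      conjTranspose_mul, hSH, hRH, Matrix.mul_assoc, trace_mul_comm R]
    simp only [Matrix.mul_assoc]
  · intro c
    simp only [LinearMap.comp_apply, LinearMap.mulLeft_apply]
    refine (re_trace_mul_krausDual_le A hA hSH (X c)).trans (le_of_eq ?_)
    have e := re_trace_diagonal_mul_diagonal_mul p (fun _ => 1) (Matrix.of fun i j => c (i, j))
    simp only [Complex.ofReal_one, diagonal_one, mul_one, of_apply, Prod.mk.eta] at e
    rw [← e, hSS, ← hΦA, hρU, hX]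
    set C : Matrix n n ℂ := Matrix.of fun i j => c (i, j)
    set D : Matrix n n ℂ := diagonal fun i => (p i : ℂ)
    have : U * D * Uᴴ * (U * C * Vᴴ * (U * C * Vᴴ)ᴴ) =
        U * (D * (Uᴴ * U) * C * (Vᴴ * V) * Cᴴ) * Uᴴ := by
      simp only [conjTranspose_mul, conjTranspose_conjTranspose, Matrix.mul_assoc]
    rw [this, hU1, hV1, Matrix.mul_one, Matrix.mul_one, trace_mul_comm, ← Matrix.mul_assoc, hU1,
      Matrix.one_mul]
  · intro c
    simp only [LinearMap.comp_apply, LinearMap.mulRight_apply]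
    -- The adjoint of `X c` is used because `R` multiplies from the right.
    have h0 := re_trace_mul_krausDual_le A hA hRH (X c)ᴴ
    rw [krausDual_conjTranspose, conjTranspose_mul, conjTranspose_conjTranspose, hRH,
      conjTranspose_conjTranspose, trace_mul_comm] at h0
    rw [conjTranspose_mul, hRH]
    refine h0.trans (le_of_eq ?_)
    have e := re_trace_diagonal_mul_diagonal_mul (fun _ => 1) q (Matrix.of fun i j => c (i, j))
    simp only [Complex.ofReal_one, diagonal_one, one_mul, of_apply, Prod.mk.eta] at e
    rw [← e, hRR, ← hΦA, hσV, hX]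
    set C : Matrix n n ℂ := Matrix.of fun i j => c (i, j)
    set D : Matrix n n ℂ := diagonal fun i => (q i : ℂ)
    have : V * D * Vᴴ * ((U * C * Vᴴ)ᴴ * (U * C * Vᴴ)) =
        V * (D * (Vᴴ * V) * Cᴴ * (Uᴴ * U) * C) * Vᴴ := by
      simp only [conjTranspose_mul, conjTranspose_conjTranspose, Matrix.mul_assoc]
    rw [this, hU1, hV1, Matrix.mul_one, Matrix.mul_one, trace_mul_comm, ← Matrix.mul_assoc, hV1,
      Matrix.one_mul, trace_mul_comm, ← Matrix.mul_assoc]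

end affinity

/-! ### Pinchings and the incoherent part of the square root -/

section pinching

variable {n : Type*} [Fintype n] {m : ℕ}

/-- The pinching `X ↦ ∑ₖ Qₖ X Qₖ`. -/
def pinching (Q : Fin m → Matrix n n ℂ) (X : Matrix n n ℂ) : Matrix n n ℂ :=
  ∑ k, Q k * X * Q k

theorem trace_mul_pinching (Q : Fin m → Matrix n n ℂ) (X Y : Matrix n n ℂ) :
    (X * pinching Q Y).trace = (pinching Q X * Y).trace := by
  simp only [pinching, Matrix.mul_sum, Matrix.sum_mul, trace_sum]
  refine Finset.sum_congr rfl fun k _ => ?_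
  rw [← Matrix.mul_assoc, trace_mul_comm]
  simp only [Matrix.mul_assoc]

variable [DecidableEq n] {Q : Fin m → Matrix n n ℂ} (hQ : IsProjectiveMeasurement Q)

include hQ

theorem mul_pinching (j : Fin m) (X : Matrix n n ℂ) : Q j * pinching Q X = Q j * X * Q j := by
  rw [pinching, Matrix.mul_sum, Finset.sum_eq_single j]
  · rw [← Matrix.mul_assoc, ← Matrix.mul_assoc, hQ.idem]
  · intro k _ hk
    rw [← Matrix.mul_assoc, ← Matrix.mul_assoc, hQ.orthogonal j k hk.symm]
    simp
  · simp

theorem pinching_mul (j : Fin m) (X : Matrix n n ℂ) : pinching Q X * Q j = Q j * X * Q j := by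
  rw [pinching, Matrix.sum_mul, Finset.sum_eq_single j]
  · rw [Matrix.mul_assoc, hQ.idem]
  · intro k _ hk
    rw [Matrix.mul_assoc, hQ.orthogonal k j hk]
    simp
  · simp

theorem commute_pinching (j : Fin m) (X : Matrix n n ℂ) : Commute (pinching Q X) (Q j) := by
  rw [commute_iff_eq, mul_pinching hQ, pinching_mul hQ]

theorem pinching_eq_self_of_commute {X : Matrix n n ℂ} (h : ∀ j, Commute X (Q j)) :
    pinching Q X = X := by
  have : ∀ k, Q k * X * Q k = X * Q k := fun k => by
    rw [← (h k).eq, Matrix.mul_assoc, hQ.idem]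
  simp only [pinching, this]
  rw [← Matrix.mul_sum, hQ.complete, Matrix.mul_one]

theorem pinching_posSemidef {X : Matrix n n ℂ} (hX : X.PosSemidef) :
    (pinching Q X).PosSemidef := by
  refine posSemidef_sum _ fun k _ => ?_
  have := hX.mul_mul_conjTranspose_same (Q k)
  rwa [(hQ.hermitian k).eq] at this

theorem pinching_pinching (X : Matrix n n ℂ) : pinching Q (pinching Q X) = pinching Q X :=
  pinching_eq_self_of_commute hQ fun j => commute_pinching hQ j X

/-- A fixed point commutes with every `Q j`, and the functional calculus preserves commutation. -/
theorem pinching_msqrt_eq_self {X : Matrix n n ℂ} (h : pinching Q X = X) :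
    pinching Q (msqrt X) = msqrt X :=
  pinching_eq_self_of_commute hQ fun j => commute_msqrt (h ▸ commute_pinching hQ j X)

/-- Pythagoras: the pinching is self-adjoint and idempotent for the trace pairing. -/
theorem hsNorm_sub_pinching_sq {X : Matrix n n ℂ} (hX : X.PosSemidef) :
    hsNorm (X - pinching Q X) ^ 2 =
      (X * X).trace.re - (pinching Q X * pinching Q X).trace.re := by
  have hP := pinching_posSemidef hQ hX
  rw [hsNorm, Real.sq_sqrt (re_trace_conjTranspose_mul_self_nonneg _), conjTranspose_sub, hX.1.eq,
    hP.1.eq, Matrix.sub_mul, Matrix.mul_sub, Matrix.mul_sub]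
  have h1 : (X * pinching Q X).trace = (pinching Q X * pinching Q X).trace := by
    conv_lhs => rw [← pinching_pinching hQ, trace_mul_pinching]
  have h2 : (pinching Q X * X).trace = (pinching Q X * pinching Q X).trace := by
    rw [trace_mul_comm, h1]
  simp [h1, h2]

/-- A completely positive trace preserving map that preserves the states fixed by a pinching does
not decrease `tr (Π(√ρ)²)`. -/
theorem re_trace_pinching_msqrt_sq_le {Φ : Matrix n n ℂ →ₗ[ℂ] Matrix n n ℂ} (hΦ : IsCPTP Φ)
    (hinc : ∀ σ, IsState σ → pinching Q σ = σ → IsState (Φ σ) ∧ pinching Q (Φ σ) = Φ σ)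
    {ρ : Matrix n n ℂ} (hρ : ρ.PosSemidef) :
    (pinching Q (msqrt ρ) * pinching Q (msqrt ρ)).trace.re ≤
      (pinching Q (msqrt (Φ ρ)) * pinching Q (msqrt (Φ ρ))).trace.re := by
  set S := msqrt ρ with hS
  set S' := msqrt (Φ ρ) with hS'
  set D := pinching Q S with hD
  have hDp : D.PosSemidef := pinching_posSemidef hQ (msqrt_posSemidef ρ)
  have hDp' : (pinching Q S').PosSemidef := pinching_posSemidef hQ (msqrt_posSemidef (Φ ρ))
  set t : ℝ := (D * D).trace.re with ht
  have hDD : (D * D).PosSemidef := by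
    have := posSemidef_conjTranspose_mul_self D
    rwa [hDp.1.eq] at this
  have htc : (D * D).trace = (t : ℂ) := by
    have := (Complex.le_def.1 hDD.trace_nonneg).2
    exact Complex.ext rfl (by simpa using this.symm)
  set t' : ℝ := (pinching Q S' * pinching Q S').trace.re with ht'
  have ht'0 : 0 ≤ t' := by
    have := re_trace_conjTranspose_mul_self_nonneg (pinching Q S')
    rwa [hDp'.1.eq] at this
  have ht0 : 0 ≤ t := by
    have := re_trace_conjTranspose_mul_self_nonneg D
    rwa [hDp.1.eq] at this
  rcases ht0.eq_or_lt with h0 | htpos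
  · rw [← h0]; exact ht'0
  set s : ℝ := √t with hs
  have hs0 : 0 < s := Real.sqrt_pos.2 htpos
  have hss : s * s = t := Real.mul_self_sqrt ht0
  -- `E * E` is the incoherent test state, and `E` is its square root; dividing by `s = √t` gives
  -- trace one.
  set E : Matrix n n ℂ := ((s⁻¹ : ℝ) : ℂ) • D with hE
  have hs' : (0 : ℂ) ≤ ((s⁻¹ : ℝ) : ℂ) := Complex.zero_le_real.2 (inv_pos.2 hs0).le
  have hEp : E.PosSemidef := hDp.smul hs'
  have hEE : (E * E).trace = 1 := by
    rw [hE, Matrix.smul_mul, Matrix.mul_smul, smul_smul, trace_smul, htc, smul_eq_mul]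
    have : s⁻¹ * s⁻¹ * t = 1 := by rw [← hss]; field_simp
    exact_mod_cast this
  have hstate : IsState (E * E) := by
    refine ⟨?_, hEE⟩
    have := posSemidef_conjTranspose_mul_self E
    rwa [hEp.1.eq] at this
  have hEc : ∀ j, Commute E (Q j) := fun j => (commute_pinching hQ j S).smul_left _
  obtain ⟨hst', hfix⟩ := hinc (E * E) hstate
    (pinching_eq_self_of_commute hQ fun j => (hEc j).mul_left (hEc j))
  have hmono := re_trace_msqrt_mul_msqrt_le hΦ hρ hstate.1
  rw [msqrt_mul_self_eq hEp, ← hS, ← hS'] at hmono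
  set T := msqrt (Φ (E * E)) with hT
  have hTp : T.PosSemidef := msqrt_posSemidef _
  have hTfix : pinching Q T = T := pinching_msqrt_eq_self hQ hfix
  have hTT : (T * T).trace = 1 := by rw [hT, msqrt_mul_self hst'.1, hst'.2]
  have h1 : (S * E).trace.re = s := by
    have e1 : (S * D).trace = (D * D).trace := by
      conv_lhs => rw [hD, ← pinching_pinching hQ, trace_mul_pinching]
    rw [hE, Matrix.mul_smul, trace_smul, e1, htc, smul_eq_mul, ← Complex.ofReal_mul,
      Complex.ofReal_re, ← hss]
    field_simp
  -- As `T` is fixed, `S'` may be replaced by its pinching; Cauchy-Schwarz applies with `tr T² = 1`.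
  have h2 : (S' * T).trace.re ≤ √t' := by
    rw [← hTfix, trace_mul_pinching]
    refine (Complex.re_le_norm _).trans (Real.le_sqrt_of_sq_le ?_)
    have := norm_trace_conjTranspose_mul_sq_le (pinching Q S') T
    rwa [hDp'.1.eq, hTp.1.eq, hTT, Complex.one_re, mul_one] at this
  rw [h1] at hmono
  exact (Real.sqrt_le_sqrt_iff ht'0).1 (hmono.trans h2)

end pinching

/-! ### Coherence relative to the weak measurements -/

theorem IsCPTP.isState {n : Type*} [Fintype n] [DecidableEq n]
    {Φ : Matrix n n ℂ →ₗ[ℂ] Matrix n n ℂ} (hΦ : IsCPTP Φ) {ρ : Matrix n n ℂ} (hρ : IsState ρ) :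
    IsState (Φ ρ) := by
  obtain ⟨r, A, hA, hΦA⟩ := hΦ
  refine ⟨?_, ?_⟩
  · rw [hΦA]
    exact posSemidef_sum _ fun k _ => hρ.1.mul_mul_conjTranspose_same _
  · have := trace_mul_krausDual A ρ 1
    rw [Matrix.mul_one, ← hΦA] at this
    rw [← this]
    simp [krausDual_apply, hA, hρ.2]

theorem hsNorm_smul_sq {n : Type*} [Fintype n] (c : ℝ) (X : Matrix n n ℂ) :
    hsNorm ((c : ℂ) • X) ^ 2 = c ^ 2 * hsNorm X ^ 2 := by
  rw [hsNorm, hsNorm, Real.sq_sqrt (re_trace_conjTranspose_mul_self_nonneg _),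
    Real.sq_sqrt (re_trace_conjTranspose_mul_self_nonneg _)]
  simp [sq, mul_assoc]

variable {a b : Type*} [Fintype a] [DecidableEq a] [Fintype b] [DecidableEq b]

theorem IsProjectiveMeasurement.kronecker_one {m : ℕ} {P : Fin m → Matrix a a ℂ}
    (hP : IsProjectiveMeasurement P) :
    IsProjectiveMeasurement fun k => P k ⊗ₖ (1 : Matrix b b ℂ) where
  hermitian k := by
    rw [IsHermitian, conjTranspose_kronecker, (hP.hermitian k).eq, conjTranspose_one]
  idem k := by rw [← mul_kronecker_mul, hP.idem, Matrix.one_mul]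
  orthogonal j k h := by rw [← mul_kronecker_mul, hP.orthogonal j k h, zero_kronecker]
  complete := by
    have h : ∀ s : Finset (Fin m), ∑ k ∈ s, P k ⊗ₖ (1 : Matrix b b ℂ) = (∑ k ∈ s, P k) ⊗ₖ 1 := by
      intro s
      induction s using Finset.induction_on with
      | empty => simp
      | insert i s hi ih => rw [Finset.sum_insert hi, Finset.sum_insert hi, ih, add_kronecker]
    rw [h, hP.complete, one_kronecker_one]

theorem coherence_weakMeasMix {m : ℕ} {P : Fin m → Matrix a a ℂ} (hP : IsProjectiveMeasurement P)
    (x : ℝ) {ρ : Matrix (a × b) (a × b) ℂ} (hρ : IsState ρ) :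
    coherence (weakMeasMix x P) ρ = (1 - 2 * tau₁ x * tau₂ x) ^ 2 *
      (1 - (localMeas P (msqrt ρ) * localMeas P (msqrt ρ)).trace.re) := by
  have h := hsNorm_sub_pinching_sq (hP.kronecker_one (b := b)) (msqrt_posSemidef ρ)
  rw [msqrt_mul_self hρ.1, hρ.2, Complex.one_re] at h
  rw [coherence]
  have e : msqrt ρ - weakMeasMix x P (msqrt ρ) = ((1 - 2 * tau₁ x * tau₂ x : ℝ) : ℂ) •
      (msqrt ρ - pinching (fun k => P k ⊗ₖ (1 : Matrix b b ℂ)) (msqrt ρ)) := by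
    rw [weakMeasMix]
    change _ - (_ + _ • pinching (fun k => P k ⊗ₖ (1 : Matrix b b ℂ)) (msqrt ρ)) = _
    push_cast
    module
  rw [e, hsNorm_smul_sq, h]
  rfl

theorem tau_sq_add_tau_sq (x : ℝ) : tau₁ x * tau₁ x + tau₂ x * tau₂ x = 1 := by
  have h := Real.tanh_bijOn.mapsTo (Set.mem_univ x)
  rw [tau₁, tau₂, Real.mul_self_sqrt (by linarith [h.2]),
    Real.mul_self_sqrt (by linarith [h.1])]
  ring

/-- The two-outcome weak measurement is the mixture of the identity and the local measurement. -/
theorem weakMeas_eq_weakMeasMix {P : Fin 2 → Matrix a a ℂ} (hP : IsProjectiveMeasurement P)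
    (x : ℝ) : weakMeas (b := b) x P = weakMeasMix x P := by
  funext X
  have hQ := (hP.kronecker_one (b := b)).complete
  rw [Fin.sum_univ_two] at hQ
  have ht : (tau₁ x : ℂ) * tau₁ x + tau₂ x * tau₂ x = 1 := by
    exact_mod_cast tau_sq_add_tau_sq x
  simp only [weakMeas, weakMeasMix, weakOpPos, weakOpNeg, localMeas, Fin.sum_univ_two,
    add_kronecker, smul_kronecker]
  set A := P 0 ⊗ₖ (1 : Matrix b b ℂ)
  set B := P 1 ⊗ₖ (1 : Matrix b b ℂ)
  set s : ℂ := (tau₁ x : ℂ)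
  set t : ℂ := (tau₂ x : ℂ)
  -- Blockwise, both maps multiply diagonal blocks by `τ₁² + τ₂² = 1` and off-diagonal blocks by `2
  -- τ₁ τ₂`.
  have hX : X = A * X * A + A * X * B + (B * X * A + B * X * B) := by
    calc X = (A + B) * X * (A + B) := by rw [hQ, Matrix.one_mul, Matrix.mul_one]
      _ = _ := by simp only [Matrix.add_mul, Matrix.mul_add]; abel
  push_cast
  conv_rhs => enter [1, 2]; rw [hX]
  simp only [Matrix.add_mul, Matrix.mul_add, Matrix.smul_mul, Matrix.mul_smul]
  rw [← ht]
  module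

theorem coherence_weakMeasMix_le {m : ℕ} {P : Fin m → Matrix a a ℂ}
    (hP : IsProjectiveMeasurement P) (x : ℝ)
    {Φ : Matrix (a × b) (a × b) ℂ →ₗ[ℂ] Matrix (a × b) (a × b) ℂ}
    (hΦ : IsPartiallyIncoherentCPTP P Φ) {ρ : Matrix (a × b) (a × b) ℂ} (hρ : IsState ρ) :
    coherence (weakMeasMix x P) (Φ ρ) ≤ coherence (weakMeasMix x P) ρ := by
  rw [coherence_weakMeasMix hP x hρ, coherence_weakMeasMix hP x (hΦ.1.isState hρ)]
  refine mul_le_mul_of_nonneg_left (sub_le_sub_left ?_ 1) (sq_nonneg _)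
  exact re_trace_pinching_msqrt_sq_le (hP.kronecker_one (b := b)) hΦ.1
    (fun σ h1 h2 => hΦ.2 ⟨σ, ⟨h1, h2⟩, rfl⟩) hρ.1

end WeakCoherence

theorem mainTheorem3 {a b : Type*} [Fintype a] [DecidableEq a] [Fintype b] [DecidableEq b]
    (x : ℝ) (ρ : Matrix (a × b) (a × b) ℂ) (hρ : WeakCoherence.IsState ρ)
    (Φ : Matrix (a × b) (a × b) ℂ →ₗ[ℂ] Matrix (a × b) (a × b) ℂ) :
    (∀ P : Fin 2 → Matrix a a ℂ, WeakCoherence.IsProjectiveMeasurement P →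
      WeakCoherence.IsPartiallyIncoherentCPTP P Φ →
        WeakCoherence.coherence (WeakCoherence.weakMeas x P) (Φ ρ) ≤
          WeakCoherence.coherence (WeakCoherence.weakMeas x P) ρ) ∧
    (∀ (m : ℕ) (P : Fin m → Matrix a a ℂ), WeakCoherence.IsProjectiveMeasurement P →
      WeakCoherence.IsPartiallyIncoherentCPTP P Φ →
        WeakCoherence.coherence (WeakCoherence.weakMeasMix x P) (Φ ρ) ≤
          WeakCoherence.coherence (WeakCoherence.weakMeasMix x P) ρ) := by
  refine ⟨fun P hP hΦ => ?_, fun m P hP hΦ => WeakCoherence.coherence_weakMeasMix_le hP x hΦ hρ⟩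
  rw [WeakCoherence.weakMeas_eq_weakMeasMix hP x]
  exact WeakCoherence.coherence_weakMeasMix_le hP x hΦ hρ
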